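/- Let $n\ge 1$ and $m\ge 0$ be integers, let $\mathbb S^{n-1}=\{x\in\mathbb R^n:\|x\|=1\}$ be the Euclidean unit sphere with surface measure $\sigma$, let $f_0,f_1,\dots,f_m$ be real polynomials in $n$ variables, and let $b_1,\dots,b_m\in\mathbb R$. Let $\mathcal M$ be either the convex cone of all positive finite Borel measures on $\mathbb S^{n-1}$ or the set of all Borel probability measures on $\mathbb S^{n-1}$. Consider the generalized problem of moments $$val=\inf_{\nu\in\mathcal M}\Big\{\int_{\mathbb S^{n-1}} f_0\,d\nu \;:\; \int_{\mathbb S^{n-1}} f_i\,d\nu=b_i\quad (i=1,\dots,m)\Big\},$$ and assume that it has an optimal solution, i.e. that the infimum is attained by a feasible measure. Then there are polynomials $h_r$ ($r\in\mathbb N$), each a sum of squares of real polynomials and of degree at most $2r$, and a constant $C$ that does not depend on $r$ (it may depend on $n$, $m$, $\mathcal M$, the $f_i$ and the $b_i$), such that for every integer $r\ge 1$ $$\Big|\int_{\mathbb S^{n-1}} f_0(x)\,h_r(x)\,d\sigma(x)-val\Big|\le \frac{C}{r} \qquad\text{and}\qquad \Big|\int_{\mathbb S^{n-1}} f_i(x)\,h_r(x)\,d\sigma(x)-b_i\Big|\le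 \frac{C}{r}\quad (i=1,\dots,m).$$ -/

import Mathlib

open MeasureTheory

noncomputable section

namespace SphereMoments

/-- The unit sphere `S^{n-1} = {x ∈ ℝⁿ : ‖x‖ = 1}` (Euclidean norm). -/
abbrev unitSphere (n : ℕ) : Set (EuclideanSpace ℝ (Fin n)) :=
  Metric.sphere (0 : EuclideanSpace ℝ (Fin n)) 1

/-- The surface measure `σ` on `S^{n-1}`; its total mass is `n · vol(unit ball)`. -/
def surfaceMeasure (n : ℕ) : Measure (unitSphere n) :=
  (volume : Measure (EuclideanSpace ℝ (Fin n))).toSphere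

/-- The function on `K ⊆ ℝⁿ` given by a real polynomial in `n` variables. -/
def polyFun {n : ℕ} (K : Set (EuclideanSpace ℝ (Fin n))) (p : MvPolynomial (Fin n) ℝ) (x : K) : ℝ :=
  MvPolynomial.eval (fun j => (x : EuclideanSpace ℝ (Fin n)) j) p

/-- `Σ[x]_r`: sums of squares of real polynomials, of degree at most `2r`. -/
def sosPolys (n r : ℕ) : Set (MvPolynomial (Fin n) ℝ) :=
  {h | IsSumSq h ∧ h.totalDegree ≤ 2 * r}

/-- The convex cone of positive finite Borel measures on `K`. -/
def positiveMeasures {n : ℕ} (K : Set (EuclideanSpace ℝ (Fin n))) : Set (Measure K) :=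
  {ν | IsFiniteMeasure ν}

/-- The Borel probability measures on `K`. -/
def probabilityMeasures {n : ℕ} (K : Set (EuclideanSpace ℝ (Fin n))) : Set (Measure K) :=
  {ν | IsProbabilityMeasure ν}

/-- The feasible set of the generalized problem of moments over the class `M` of measures:
those `ν ∈ M` with `∫ f_i dν = b_i` for all `i`. -/
def gpmFeasible {n m : ℕ} {K : Set (EuclideanSpace ℝ (Fin n))} (M : Set (Measure K))
    (f : Fin m → K → ℝ) (b : Fin m → ℝ) : Set (Measure K) :=
  {ν | ν ∈ M ∧ ∀ i, ∫ x, f i x ∂ν = b i}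

/-- The optimal value `val`, the infimum of `∫ f₀ dν` over feasible `ν`. -/
def gpmVal {n m : ℕ} {K : Set (EuclideanSpace ℝ (Fin n))} (M : Set (Measure K))
    (f₀ : K → ℝ) (f : Fin m → K → ℝ) (b : Fin m → ℝ) : ℝ :=
  sInf ((fun ν : Measure K => ∫ x, f₀ x ∂ν) '' gpmFeasible M f b)

/-- `ν` is an optimal solution: it is feasible and no feasible measure has a smaller objective. -/
def IsGPMOptimal {n m : ℕ} {K : Set (EuclideanSpace ℝ (Fin n))} (M : Set (Measure K))
    (f₀ : K → ℝ) (f : Fin m → K → ℝ) (b : Fin m → ℝ) (ν : Measure K) : Prop :=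
  ν ∈ gpmFeasible M f b ∧ ∀ ν' ∈ gpmFeasible M f b, ∫ x, f₀ x ∂ν ≤ ∫ x, f₀ x ∂ν'

end SphereMoments

end

/-! Write `t = ⟪y, x⟫` for a point `y` of the sphere. The square `(t^k (1 + t))²` has degree at most
`2(k + 1)`; for large `k` the factor `t^(2k)` concentrates it at `±y`, and `(1 + t)²` removes `-y`.
Divided by its mass, it is an approximate delta at `y`.

The rate is `1/k` rather than `1/√k` because both the kernel and `σ` are invariant under reflection
in the line `ℝ y`. Averaging `p` over this reflection turns the first-order error at `y` into `O(1 -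
t)` (`exists_symmetrization_bound`), and the kernel mean of `1 - t` is `O(1/k)` by the exact moment
recursion `sphereMoment_add_two`. Hence `exists_kernel_approx`, uniformly in `y`.

An optimal `ν` is replaced by finitely many atoms (`exists_atomic_approx`), and each atom by its
kernel. The number of atoms may grow with `r`, but only their total mass enters the constant. -/

namespace SphereMoments

/-! ### Moments of the surface measure, via Gaussian integrals. -/

section SphereIntegrals

open Set Module

variable {E : Type*} [NormedAddCommGroup E] [InnerProductSpace ℝ E] [FiniteDimensional ℝ E]
  [MeasurableSpace E] [BorelSpace E] [Nontrivial E]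

/-- Integration in polar coordinates of a positively homogeneous function times a radial one. -/
theorem integral_homogeneous_mul_radial {g : E → ℝ} {k : ℕ}
    (hg : ∀ (x : E) (c : ℝ), 0 < c → g (c • x) = c ^ k * g x) (φ : ℝ → ℝ) :
    ∫ x, g x * φ ‖x‖ =
      (∫ ω : Metric.sphere (0 : E) 1, g ω ∂(volume : Measure E).toSphere) *
        ∫ t in Ioi (0 : ℝ), t ^ (finrank ℝ E - 1 + k) * φ t := by
  have key : ∀ x : ({(0 : E)}ᶜ : Set E), g x * φ ‖(x : E)‖ =
      g (homeomorphUnitSphereProd E x).1 *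
        ((fun t : ℝ => t ^ k * φ t) (homeomorphUnitSphereProd E x).2) := by
    intro x
    have hx : (x : E) ≠ 0 := x.2
    have hx' : 0 < ‖(x : E)‖ := norm_pos_iff.2 hx
    have h1 := hg (‖(x : E)‖⁻¹ • (x : E)) ‖(x : E)‖ hx'
    rw [smul_inv_smul₀ hx'.ne'] at h1
    simp only [homeomorphUnitSphereProd_apply_fst_coe, homeomorphUnitSphereProd_apply_snd_coe]
    rw [h1]
    ring
  calc
    ∫ x, g x * φ ‖x‖ = ∫ x : ({(0 : E)}ᶜ : Set E), g x * φ ‖(x : E)‖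
          ∂((volume : Measure E).comap Subtype.val) := by
      rw [integral_subtype_comap (measurableSet_singleton _).compl fun x : E => g x * φ ‖x‖,
        restrict_compl_singleton]
    _ = ∫ x : ({(0 : E)}ᶜ : Set E), (fun p : Metric.sphere (0 : E) 1 × Ioi (0 : ℝ) =>
          g p.1 * ((p.2 : ℝ) ^ k * φ p.2)) (homeomorphUnitSphereProd E x)
          ∂((volume : Measure E).comap Subtype.val) :=
      integral_congr_ae (.of_forall key)
    _ = ∫ p : Metric.sphere (0 : E) 1 × Ioi (0 : ℝ), g p.1 * ((p.2 : ℝ) ^ k * φ p.2)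
          ∂(volume : Measure E).toSphere.prod (.volumeIoiPow (finrank ℝ E - 1)) :=
      (volume : Measure E).measurePreserving_homeomorphUnitSphereProd.integral_comp
        (Homeomorph.measurableEmbedding _) (fun p : Metric.sphere (0 : E) 1 × Ioi (0 : ℝ) =>
          g p.1 * ((p.2 : ℝ) ^ k * φ p.2))
    _ = (∫ ω : Metric.sphere (0 : E) 1, g ω ∂(volume : Measure E).toSphere) *
        ∫ t : Ioi (0 : ℝ), (t : ℝ) ^ k * φ t ∂(.volumeIoiPow (finrank ℝ E - 1)) :=
      integral_prod_mul (fun ω : Metric.sphere (0 : E) 1 => g ω)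
        (fun t : Ioi (0 : ℝ) => (t : ℝ) ^ k * φ t)
    _ = _ := by
      congr 1
      simp only [Measure.volumeIoiPow, ENNReal.ofReal]
      rw [integral_withDensity_eq_integral_smul,
        integral_subtype_comap measurableSet_Ioi
          fun a : ℝ => Real.toNNReal (a ^ (finrank ℝ E - 1)) • (a ^ k * φ a),
        setIntegral_congr_fun measurableSet_Ioi fun x hx => ?_]
      · rw [NNReal.smul_def, Real.coe_toNNReal _ (pow_nonneg (mem_Ioi.1 hx).le _), smul_eq_mul,
          pow_add, mul_assoc]
      · exact (measurable_subtype_coe.pow_const _).real_toNNReal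

theorem integral_pow_mul_exp_neg_sq (q : ℕ) :
    ∫ t in Ioi (0 : ℝ), t ^ q * Real.exp (-t ^ 2) = 1 / 2 * Real.Gamma ((q + 1) / 2) := by
  have h := integral_rpow_mul_exp_neg_rpow (p := 2) (q := q) two_pos
    (by have : (0 : ℝ) ≤ q := q.cast_nonneg
        linarith)
  simpa only [Real.rpow_natCast, Real.rpow_two] using h

theorem integral_pow_mul_exp_neg_sq_pos (q : ℕ) :
    0 < ∫ t in Ioi (0 : ℝ), t ^ q * Real.exp (-t ^ 2) := by
  rw [integral_pow_mul_exp_neg_sq]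
  have := Real.Gamma_pos_of_pos (show (0 : ℝ) < (q + 1) / 2 by positivity)
  positivity

theorem integral_pow_mul_exp_neg_sq_add_two (q : ℕ) :
    ∫ t in Ioi (0 : ℝ), t ^ (q + 2) * Real.exp (-t ^ 2) =
      (q + 1) / 2 * ∫ t in Ioi (0 : ℝ), t ^ q * Real.exp (-t ^ 2) := by
  simp only [integral_pow_mul_exp_neg_sq]
  have h : (((q + 2 : ℕ) : ℝ) + 1) / 2 = ((q : ℝ) + 1) / 2 + 1 := by push_cast; ring
  rw [h, Real.Gamma_add_one (by positivity)]
  ring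

/-- The surface measure is invariant under linear isometries. -/
theorem integral_toSphere_comp_isometry (e : E ≃ₗᵢ[ℝ] E) (g : E → ℝ) :
    ∫ ω : Metric.sphere (0 : E) 1, g (e ω) ∂(volume : Measure E).toSphere =
      ∫ ω : Metric.sphere (0 : E) 1, g ω ∂(volume : Measure E).toSphere := by
  -- Extending `g` to be homogeneous of degree 0 reduces the claim to the invariance of Lebesgue
  -- measure: both sides acquire the same nonzero radial factor.
  set G : E → ℝ := fun x => g (‖x‖⁻¹ • x) with hG
  have hhom : ∀ (x : E) (c : ℝ), 0 < c → G (c • x) = c ^ 0 * G x := by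
    intro x c hc
    simp only [hG, norm_smul, Real.norm_eq_abs, abs_of_pos hc, pow_zero, one_mul, smul_smul,
      mul_inv]
    congr 2
    field_simp
  have hG1 : ∀ ω : Metric.sphere (0 : E) 1, G ω = g ω := fun ω => by
    have : ‖(ω : E)‖ = 1 := by simp
    simp [hG, this]
  have hG2 : ∀ ω : Metric.sphere (0 : E) 1, G (e ω) = g (e ω) := fun ω => by
    have : ‖(ω : E)‖ = 1 := by simp
    simp [hG, this]
  have h1 := integral_homogeneous_mul_radial hhom fun t => Real.exp (-t ^ 2)
  have h2 := integral_homogeneous_mul_radial (g := fun x => G (e x)) (k := 0)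
    (fun x c hc => by simp only [map_smul]; exact hhom _ c hc) fun t => Real.exp (-t ^ 2)
  have h3 : ∫ x, G (e x) * Real.exp (-‖x‖ ^ 2) = ∫ x, G x * Real.exp (-‖x‖ ^ 2) := by
    have := e.measurePreserving.integral_comp e.toHomeomorph.measurableEmbedding
      (fun x => G x * Real.exp (-‖x‖ ^ 2))
    simpa using this
  simp only [hG1] at h1
  simp only [hG2] at h2
  exact mul_right_cancel₀ (integral_pow_mul_exp_neg_sq_pos _).ne' (h2.symm.trans (h3.trans h1))

theorem integrable_inner_pow_mul_exp_neg_sq (y : E) (j : ℕ) :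
    Integrable fun x : E => inner ℝ y x ^ j * Real.exp (-‖x‖ ^ 2) := by
  have hrad : Integrable fun x : E => ‖x‖ ^ j * Real.exp (-‖x‖ ^ 2) := by
    rw [integrable_fun_norm_addHaar volume (f := fun t : ℝ => t ^ j * Real.exp (-t ^ 2))]
    have h := integrableOn_rpow_mul_exp_neg_rpow (p := 2) (s := (finrank ℝ E - 1 + j : ℕ))
      (by have : (0 : ℝ) ≤ (finrank ℝ E - 1 + j : ℕ) := Nat.cast_nonneg _
          linarith) two_pos
    simp only [Real.rpow_natCast, Real.rpow_two] at h
    refine h.congr_fun (fun t _ => ?_) measurableSet_Ioi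
    simp only [smul_eq_mul, pow_add]
    ring
  refine (hrad.const_mul (‖y‖ ^ j)).mono' (by fun_prop) (.of_forall fun x => ?_)
  rw [norm_mul, norm_pow, Real.norm_of_nonneg (Real.exp_pos _).le, ← mul_assoc, ← mul_pow]
  gcongr
  exact norm_inner_le_norm y x

/-- Integration by parts: the derivative of `exp (-‖x‖²)` along `y` is `-2 ⟪y, x⟫ exp (-‖x‖²)`. -/
theorem two_mul_integral_inner_pow_add_two {y : E} (hy : ‖y‖ = 1) (j : ℕ) :
    2 * ∫ x : E, inner ℝ y x ^ (j + 2) * Real.exp (-‖x‖ ^ 2) =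
      (j + 1) * ∫ x : E, inner ℝ y x ^ j * Real.exp (-‖x‖ ^ 2) := by
  have hf : ∀ x : E, HasFDerivAt (fun x : E => inner ℝ y x ^ (j + 1))
      (((j + 1 : ℕ) * inner ℝ y x ^ j) • innerSL ℝ y) x := fun x => by
    simpa using ((innerSL ℝ y).hasFDerivAt (x := x)).pow (j + 1)
  have hg : ∀ x : E, HasFDerivAt (fun x : E => Real.exp (-‖x‖ ^ 2))
      (Real.exp (-‖x‖ ^ 2) • -(2 • innerSL ℝ x : E →L[ℝ] ℝ)) x := fun x =>
    HasFDerivAt.exp (f := fun x : E => -‖x‖ ^ 2) (hasStrictFDerivAt_norm_sq x).hasFDerivAt.neg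
  have hint := integrable_inner_pow_mul_exp_neg_sq y
  have e1 : ∀ x : E, inner ℝ y x ^ (j + 1) *
        ((Real.exp (-‖x‖ ^ 2) • -(2 • innerSL ℝ x : E →L[ℝ] ℝ)) y) =
      -2 * (inner ℝ y x ^ (j + 2) * Real.exp (-‖x‖ ^ 2)) := fun x => by
    simp [real_inner_comm]
    ring
  have e2 : ∀ x : E, ((((j + 1 : ℕ) : ℝ) * inner ℝ y x ^ j) • innerSL ℝ y) y *
      Real.exp (-‖x‖ ^ 2) = (j + 1) * (inner ℝ y x ^ j * Real.exp (-‖x‖ ^ 2)) := fun x => by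
    simp [hy]
    ring
  have h := integral_bilinear_hasFDerivAt_right_eq_neg_left_of_integrable (μ := volume)
    (B := ContinuousLinearMap.mul ℝ ℝ) (v := y)
    (f := fun x : E => inner ℝ y x ^ (j + 1)) (g := fun x : E => Real.exp (-‖x‖ ^ 2))
    (f' := fun x => ((j + 1 : ℕ) * inner ℝ y x ^ j) • innerSL ℝ y)
    (g' := fun x => Real.exp (-‖x‖ ^ 2) • -(2 • innerSL ℝ x : E →L[ℝ] ℝ))
    (by simp only [ContinuousLinearMap.mul_apply', e2]; exact (hint j).const_mul _)
    (by simp only [ContinuousLinearMap.mul_apply', e1]; exact (hint (j + 2)).const_mul _)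
    (by simpa using hint (j + 1)) (fun x _ => hf x) (fun x _ => hg x)
  simp only [ContinuousLinearMap.mul_apply', e1, e2, integral_const_mul] at h
  linarith

/-- The `j`-th moment of the surface measure in the direction `y`. -/
noncomputable def sphereMoment (y : E) (j : ℕ) : ℝ :=
  ∫ ω : Metric.sphere (0 : E) 1, inner ℝ y (ω : E) ^ j ∂(volume : Measure E).toSphere

/-- In polar coordinates each Gaussian moment is a sphere moment times a radial integral. Raising
the exponent by 2 multiplies the Gaussian moment by `(j + 1) / 2` and the radial integral by `(d +
j) / 2`, with `d` the dimension. -/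
theorem sphereMoment_add_two {y : E} (hy : ‖y‖ = 1) (j : ℕ) :
    (finrank ℝ E + j) * sphereMoment y (j + 2) = (j + 1) * sphereMoment y j := by
  have hpolar : ∀ i : ℕ, ∫ x : E, inner ℝ y x ^ i * Real.exp (-‖x‖ ^ 2) =
      sphereMoment y i * ∫ t in Ioi (0 : ℝ), t ^ (finrank ℝ E - 1 + i) * Real.exp (-t ^ 2) :=
    fun i => integral_homogeneous_mul_radial (g := fun x => inner ℝ y x ^ i)
      (fun x c _ => by simp [inner_smul_right, mul_pow]) fun t => Real.exp (-t ^ 2)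
  have h := two_mul_integral_inner_pow_add_two hy j
  rw [hpolar, hpolar, ← add_assoc, integral_pow_mul_exp_neg_sq_add_two] at h
  have hd : ((finrank ℝ E - 1 + j : ℕ) : ℝ) + 1 = finrank ℝ E + j := by
    have : 0 < finrank ℝ E := finrank_pos
    norm_cast
    omega
  rw [hd] at h
  refine mul_right_cancel₀ (integral_pow_mul_exp_neg_sq_pos (finrank ℝ E - 1 + j)).ne' ?_
  linarith

theorem sphereMoment_odd (y : E) (k : ℕ) : sphereMoment y (2 * k + 1) = 0 := by
  have h := integral_toSphere_comp_isometry (LinearIsometryEquiv.neg ℝ : E ≃ₗᵢ[ℝ] E)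
    fun x => inner ℝ y x ^ (2 * k + 1)
  simp only [LinearIsometryEquiv.coe_neg, inner_neg_right, Odd.neg_pow ⟨k, rfl⟩,
    integral_neg] at h
  unfold sphereMoment
  linarith

theorem sphereMoment_even_pos {y : E} (hy : ‖y‖ = 1) (k : ℕ) : 0 < sphereMoment y (2 * k) := by
  have hd : (0 : ℝ) < finrank ℝ E := Nat.cast_pos.2 finrank_pos
  induction k with
  | zero =>
    have : 0 < (volume : Measure E).toSphere.real univ :=
      ENNReal.toReal_pos (by rw [Ne, Measure.measure_univ_eq_zero]; exact Measure.toSphere_ne_zero _)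
        (measure_ne_top _ _)
    simpa [sphereMoment] using this
  | succ k ih =>
    have h := sphereMoment_add_two hy (2 * k)
    push_cast at h
    rw [mul_add, mul_one]
    refine pos_of_mul_pos_right (a := (finrank ℝ E : ℝ) + 2 * k) ?_ (by positivity)
    rw [h]
    positivity

end SphereIntegrals

/-! ### Polynomials near a point of the sphere, and the concentrating kernels. -/

section Kernel

variable {n : ℕ}

theorem continuous_eval_coords (p : MvPolynomial (Fin n) ℝ) :
    Continuous fun x : EuclideanSpace ℝ (Fin n) => MvPolynomial.eval (fun j => x j) p :=
  (MvPolynomial.continuous_eval p).comp (by fun_prop)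

theorem continuous_polyFun (K : Set (EuclideanSpace ℝ (Fin n))) (p : MvPolynomial (Fin n) ℝ) :
    Continuous (polyFun K p) :=
  (continuous_eval_coords p).comp continuous_subtype_val

theorem integrable_of_continuous_unitSphere {ν : Measure (unitSphere n)} [IsFiniteMeasure ν]
    {g : unitSphere n → ℝ} (hg : Continuous g) : Integrable g ν :=
  hg.integrable_of_hasCompactSupport (HasCompactSupport.of_compactSpace g)

/-- First-order Taylor expansion of a polynomial on the sphere, with uniform constants. -/
theorem exists_taylor_bound_unitSphere (p : MvPolynomial (Fin n) ℝ) :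
    ∃ C : ℝ, 0 ≤ C ∧ ∀ y : EuclideanSpace ℝ (Fin n), ‖y‖ = 1 →
      |MvPolynomial.eval (fun j => y j) p| ≤ C ∧
      ∃ l : EuclideanSpace ℝ (Fin n) →L[ℝ] ℝ, ‖l‖ ≤ C ∧
        ∀ x : EuclideanSpace ℝ (Fin n), ‖x‖ = 1 →
          |MvPolynomial.eval (fun j => x j) p - MvPolynomial.eval (fun j => y j) p - l (x - y)| ≤
            C * ‖x - y‖ ^ 2 := by
  induction p using MvPolynomial.induction_on with
  | C a =>
    refine ⟨|a|, abs_nonneg a, fun y _ => ⟨by simp, 0, by simp, fun x _ => ?_⟩⟩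
    simp only [MvPolynomial.eval_C, sub_self, zero_apply, abs_zero]
    positivity
  | add p q hp hq =>
    obtain ⟨C, hC, hp⟩ := hp
    obtain ⟨D, hD, hq⟩ := hq
    refine ⟨C + D, by positivity, fun y hy => ?_⟩
    obtain ⟨hp0, l, hl, hp1⟩ := hp y hy
    obtain ⟨hq0, l', hl', hq1⟩ := hq y hy
    refine ⟨?_, l + l', (norm_add_le _ _).trans (add_le_add hl hl'), fun x hx => ?_⟩
    · rw [map_add]
      exact (abs_add_le _ _).trans (add_le_add hp0 hq0)
    · rw [map_add, map_add, add_apply, add_mul]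
      refine le_trans (le_of_eq ?_) ((abs_add_le _ _).trans (add_le_add (hp1 x hx) (hq1 x hx)))
      congr 1
      ring
  | mul_X p i hp =>
    obtain ⟨C, hC, hp⟩ := hp
    have hcoord : ∀ x : EuclideanSpace ℝ (Fin n), |x i| ≤ ‖x‖ := fun x =>
      PiLp.norm_apply_le x i
    refine ⟨2 * C, by positivity, fun y hy => ?_⟩
    obtain ⟨hp0, l, hl, hp1⟩ := hp y hy
    have hyi : |y i| ≤ 1 := hy ▸ hcoord y
    refine ⟨?_, y i • l + MvPolynomial.eval (fun j => y j) p • EuclideanSpace.proj i, ?_,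
      fun x hx => ?_⟩
    · rw [map_mul, MvPolynomial.eval_X, abs_mul]
      nlinarith [abs_nonneg (y i)]
    · have hproj : ‖(EuclideanSpace.proj i : EuclideanSpace ℝ (Fin n) →L[ℝ] ℝ)‖ ≤ 1 :=
        ContinuousLinearMap.opNorm_le_bound _ zero_le_one fun x => by
          simpa using hcoord x
      calc _ ≤ |y i| * ‖l‖ + |MvPolynomial.eval (fun j => y j) p| *
            ‖(EuclideanSpace.proj i : EuclideanSpace ℝ (Fin n) →L[ℝ] ℝ)‖ := by
            refine (norm_add_le _ _).trans (le_of_eq ?_)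
            rw [norm_smul, norm_smul, Real.norm_eq_abs, Real.norm_eq_abs]
        _ ≤ 1 * C + C * 1 := by gcongr
        _ = 2 * C := by ring
    · have hxi : |x i| ≤ 1 := hx ▸ hcoord x
      have hxyi : |x i - y i| ≤ ‖x - y‖ := by simpa using hcoord (x - y)
      have hl2 : |l (x - y)| ≤ C * ‖x - y‖ :=
        (l.le_opNorm _).trans (mul_le_mul_of_nonneg_right hl (norm_nonneg _))
      -- Product rule: the remainder of `p * X i` is that of `p` times `x i`, plus a product of two
      -- first-order increments.
      have e : MvPolynomial.eval (fun j => x j) (p * MvPolynomial.X i) -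
          MvPolynomial.eval (fun j => y j) (p * MvPolynomial.X i) -
          (y i • l + MvPolynomial.eval (fun j => y j) p •
            EuclideanSpace.proj i : EuclideanSpace ℝ (Fin n) →L[ℝ] ℝ) (x - y) =
          (MvPolynomial.eval (fun j => x j) p - MvPolynomial.eval (fun j => y j) p - l (x - y)) *
            x i + l (x - y) * (x i - y i) := by
        simp
        ring
      rw [e]
      calc _ ≤ |MvPolynomial.eval (fun j => x j) p - MvPolynomial.eval (fun j => y j) p -
            l (x - y)| * |x i| + |l (x - y)| * |x i - y i| := by
            rw [← abs_mul, ← abs_mul]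
            exact abs_add_le _ _
        _ ≤ (C * ‖x - y‖ ^ 2) * 1 + (C * ‖x - y‖) * ‖x - y‖ := by
            gcongr
            exact hp1 x hx
        _ = 2 * C * ‖x - y‖ ^ 2 := by ring

theorem reflection_span_singleton {E : Type*} [NormedAddCommGroup E] [InnerProductSpace ℝ E]
    {y : E} (hy : ‖y‖ = 1) (x : E) :
    (ℝ ∙ y).reflection x = (2 * inner ℝ y x) • y - x := by
  rw [Submodule.reflection_apply, Submodule.starProjection_unit_singleton ℝ hy, two_smul,
    two_mul, add_smul]

/-- The symmetrization of a polynomial about a point `y` of the sphere is flat at `y`. -/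
theorem exists_symmetrization_bound (p : MvPolynomial (Fin n) ℝ) :
    ∃ C : ℝ, 0 ≤ C ∧ ∀ x y : EuclideanSpace ℝ (Fin n), ‖x‖ = 1 → ‖y‖ = 1 →
      |MvPolynomial.eval (fun j => x j) p +
          MvPolynomial.eval (fun j => (ℝ ∙ y).reflection x j) p -
          2 * MvPolynomial.eval (fun j => y j) p| ≤ C * (1 - inner ℝ y x) := by
  obtain ⟨C, hC, h⟩ := exists_taylor_bound_unitSphere p
  -- Three contributions of `2 C (1 - t)`: the Taylor remainders at `x` and at its reflection, and
  -- the linear terms.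
  refine ⟨6 * C, by positivity, fun x y hx hy => ?_⟩
  obtain ⟨-, l, hl, h1⟩ := h y hy
  have hdist : ∀ z : EuclideanSpace ℝ (Fin n), ‖z‖ = 1 →
      ‖z - y‖ ^ 2 = 2 * (1 - inner ℝ y z) := fun z hz => by
    rw [norm_sub_sq_real, hz, hy, real_inner_comm]
    ring
  have ht : inner ℝ y x ≤ (1 : ℝ) := by
    have := real_inner_le_norm y x
    rwa [hx, hy, mul_one] at this
  set R := (ℝ ∙ y).reflection x with hR
  have hRx : R = (2 * inner ℝ y x) • y - x := reflection_span_singleton hy x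
  have hRn : ‖R‖ = 1 := by rw [hR, LinearIsometryEquiv.norm_map, hx]
  have hRi : inner ℝ y R = inner ℝ y x := by
    rw [hRx, inner_sub_right, inner_smul_right, real_inner_self_eq_norm_sq, hy]
    ring
  -- As `x + R = 2 t y`, the tangential parts cancel and only a multiple `1 - t` of `y` survives.
  have hsum : l (x - y) + l (R - y) = -(2 * (1 - inner ℝ y x)) * l y := by
    rw [← map_add, show x - y + (R - y) = (-(2 * (1 - inner ℝ y x))) • y by rw [hRx]; module,
      map_smul, smul_eq_mul]
  have hly : |l y| ≤ C := by
    have := l.le_opNorm y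
    rw [hy, mul_one] at this
    exact this.trans hl
  have hx1 := h1 x hx
  have hR1 := h1 R hRn
  rw [hdist x hx] at hx1
  rw [hdist R hRn, hRi] at hR1
  have hl3 : |l (x - y) + l (R - y)| ≤ 2 * (1 - inner ℝ y x) * C := by
    rw [hsum, abs_mul, abs_neg, abs_of_nonneg (by linarith : 0 ≤ 2 * (1 - inner ℝ y x))]
    exact mul_le_mul_of_nonneg_left hly (by linarith)
  rw [abs_le] at *
  constructor <;> linarith [hx1.1, hx1.2, hR1.1, hR1.2, hl3.1, hl3.2]

/-- The linear form `x ↦ ⟪y, x⟫` as a polynomial. -/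
noncomputable def innerPoly (y : EuclideanSpace ℝ (Fin n)) : MvPolynomial (Fin n) ℝ :=
  ∑ j, MvPolynomial.C (y j) * MvPolynomial.X j

theorem eval_innerPoly (x y : EuclideanSpace ℝ (Fin n)) :
    MvPolynomial.eval (fun j => x j) (innerPoly y) = inner ℝ y x := by
  simp [innerPoly, PiLp.inner_apply, mul_comm]

theorem totalDegree_innerPoly_le (y : EuclideanSpace ℝ (Fin n)) :
    (innerPoly y).totalDegree ≤ 1 :=
  MvPolynomial.totalDegree_finsetSum_le fun j _ =>
    (MvPolynomial.totalDegree_mul _ _).trans (by simp)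

/-- The square root `⟪y, x⟫ ^ k * (1 + ⟪y, x⟫)` of the unnormalized kernel concentrated at `y`. -/
noncomputable def kernelRoot (y : EuclideanSpace ℝ (Fin n)) (k : ℕ) : MvPolynomial (Fin n) ℝ :=
  innerPoly y ^ k * (1 + innerPoly y)

theorem totalDegree_kernelRoot_le (y : EuclideanSpace ℝ (Fin n)) (k : ℕ) :
    (kernelRoot y k).totalDegree ≤ k + 1 := by
  have h1 := totalDegree_innerPoly_le y
  refine (MvPolynomial.totalDegree_mul _ _).trans (add_le_add ?_ ?_)
  · exact (MvPolynomial.totalDegree_pow _ _).trans (by simpa using Nat.mul_le_mul_left k h1)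
  · exact (MvPolynomial.totalDegree_add _ _).trans (by simpa using h1)

theorem eval_kernelRoot (x y : EuclideanSpace ℝ (Fin n)) (k : ℕ) :
    MvPolynomial.eval (fun j => x j) (kernelRoot y k) =
      inner ℝ y x ^ k * (1 + inner ℝ y x) := by
  simp [kernelRoot, eval_innerPoly]

instance : IsFiniteMeasure (surfaceMeasure n) := by
  unfold surfaceMeasure
  infer_instance

variable [Nontrivial (EuclideanSpace ℝ (Fin n))]

/-- The mass `∫ ⟪y, x⟫ ^ (2k) (1 + ⟪y, x⟫)² dσ(x)` of the unnormalized kernel. -/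
noncomputable def kernelMass (y : EuclideanSpace ℝ (Fin n)) (k : ℕ) : ℝ :=
  sphereMoment y (2 * k) + sphereMoment y (2 * k + 2)

theorem kernelMass_pos {y : EuclideanSpace ℝ (Fin n)} (hy : ‖y‖ = 1) (k : ℕ) :
    0 < kernelMass y k :=
  add_pos (sphereMoment_even_pos hy k) (sphereMoment_even_pos hy (k + 1))

theorem integral_kernel (y : EuclideanSpace ℝ (Fin n)) (k : ℕ) :
    ∫ x : unitSphere n, (inner ℝ y x.1 ^ k * (1 + inner ℝ y x.1)) ^ 2
      ∂(surfaceMeasure n) = kernelMass y k := by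
  have e : ∀ x : unitSphere n, (inner ℝ y x.1 ^ k * (1 + inner ℝ y x.1)) ^ 2 =
      inner ℝ y x.1 ^ (2 * k) + 2 * inner ℝ y x.1 ^ (2 * k + 1) +
        inner ℝ y x.1 ^ (2 * k + 2) := fun x => by ring
  simp only [e]
  rw [integral_add, integral_add, integral_const_mul]
  rotate_left
  iterate 4 exact integrable_of_continuous_unitSphere (by fun_prop)
  change sphereMoment y _ + 2 * sphereMoment y _ + sphereMoment y _ = _
  rw [sphereMoment_odd, kernelMass]
  ring

/-- The integrand is `(t^(2k) - t^(2k+2)) (1 + t)`, whose odd powers integrate to zero. -/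
theorem integral_one_sub_inner_mul_kernel (y : EuclideanSpace ℝ (Fin n)) (k : ℕ) :
    ∫ x : unitSphere n, (1 - inner ℝ y x.1) *
      (inner ℝ y x.1 ^ k * (1 + inner ℝ y x.1)) ^ 2
      ∂(surfaceMeasure n) = sphereMoment y (2 * k) - sphereMoment y (2 * k + 2) := by
  have e : ∀ x : unitSphere n, (1 - inner ℝ y x.1) *
      (inner ℝ y x.1 ^ k * (1 + inner ℝ y x.1)) ^ 2 =
      inner ℝ y x.1 ^ (2 * k) + inner ℝ y x.1 ^ (2 * k + 1) -
        inner ℝ y x.1 ^ (2 * k + 2) -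
        inner ℝ y x.1 ^ (2 * (k + 1) + 1) := fun x => by ring
  simp only [e]
  rw [integral_sub, integral_sub, integral_add]
  rotate_left
  iterate 6 exact integrable_of_continuous_unitSphere (by fun_prop)
  change sphereMoment y _ + sphereMoment y _ - sphereMoment y _ - sphereMoment y _ = _
  rw [sphereMoment_odd, sphereMoment_odd]
  ring

/-- By the recursion the integral is exactly `(n - 1) / (n + 2k)` times the moment of order `2k`. -/
theorem integral_one_sub_inner_mul_kernel_le {y : EuclideanSpace ℝ (Fin n)} (hy : ‖y‖ = 1)
    (k : ℕ) :
    ∫ x : unitSphere n, (1 - inner ℝ y x.1) *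
      (inner ℝ y x.1 ^ k * (1 + inner ℝ y x.1)) ^ 2
      ∂(surfaceMeasure n) ≤ n * kernelMass y k / (k + 1) := by
  have hn : (1 : ℝ) ≤ n := by
    have := Module.finrank_pos (R := ℝ) (M := EuclideanSpace ℝ (Fin n))
    rw [finrank_euclideanSpace_fin] at this
    exact_mod_cast this
  have h0 := sphereMoment_even_pos hy k
  have h2 : 0 < sphereMoment y (2 * k + 2) := sphereMoment_even_pos hy (k + 1)
  have hrec := sphereMoment_add_two hy (2 * k)
  rw [finrank_euclideanSpace_fin] at hrec
  push_cast at hrec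
  rw [integral_one_sub_inner_mul_kernel, le_div_iff₀ (by positivity), kernelMass]
  have hk : (0 : ℝ) ≤ k := k.cast_nonneg
  have hdiff : (n + 2 * k : ℝ) * (sphereMoment y (2 * k) - sphereMoment y (2 * k + 2)) =
      (n - 1) * sphereMoment y (2 * k) := by
    linear_combination -hrec
  refine le_of_mul_le_mul_left ?_ (by positivity : (0 : ℝ) < n + 2 * k)
  rw [← mul_assoc, hdiff]
  have hcoef : ((n : ℝ) - 1) * (k + 1) ≤ (n + 2 * k) * n := by nlinarith
  calc _ = ((n : ℝ) - 1) * (k + 1) * sphereMoment y (2 * k) := by ring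
    _ ≤ (n + 2 * k) * n * sphereMoment y (2 * k) := by gcongr
    _ ≤ (n + 2 * k) * n * (sphereMoment y (2 * k) + sphereMoment y (2 * k + 2)) := by
      gcongr
      linarith
    _ = _ := by ring

/-- Integration against the normalized kernel approximates evaluation at `y` with error
`O(1 / k)`, uniformly in `y`. -/
theorem exists_kernel_approx (p : MvPolynomial (Fin n) ℝ) :
    ∃ C : ℝ, 0 ≤ C ∧ ∀ (y : unitSphere n) (k : ℕ),
      |(∫ x, polyFun (unitSphere n) p x * polyFun (unitSphere n) (kernelRoot y.1 k) x ^ 2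
          ∂(surfaceMeasure n)) / kernelMass y.1 k - polyFun (unitSphere n) p y| ≤
        C / (k + 1) := by
  obtain ⟨C, hC, hsym⟩ := exists_symmetrization_bound p
  -- The half comes from averaging `p` with its reflection, the `n` from the bound on the kernel
  -- mean of `1 - t`.
  refine ⟨C / 2 * n, by positivity, fun y' k => ?_⟩
  obtain ⟨y, hy0⟩ := y'
  have hy : ‖y‖ = 1 := by simpa using hy0
  set F : EuclideanSpace ℝ (Fin n) → ℝ := fun x => MvPolynomial.eval (fun j => x j) p with hF
  set K : EuclideanSpace ℝ (Fin n) → ℝ := fun x => (inner ℝ y x ^ k * (1 + inner ℝ y x)) ^ 2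
    with hK
  have hFc : Continuous F := continuous_eval_coords p
  have hKc : Continuous K := by fun_prop
  have hmass := kernelMass_pos hy k
  set R := (ℝ ∙ y).reflection
  have hRc : Continuous R := R.continuous
  have hKR : ∀ x, K (R x) = K x := fun x => by
    have : inner ℝ y (R x) = inner ℝ y x := by
      rw [reflection_span_singleton hy, inner_sub_right, inner_smul_right,
        real_inner_self_eq_norm_sq, hy]
      ring
    simp only [hK, this]
  have hrefl : ∫ x : unitSphere n, F (R x) * K x ∂(surfaceMeasure n) =
      ∫ x : unitSphere n, F x * K x ∂(surfaceMeasure n) := by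
    have := integral_toSphere_comp_isometry R fun x => F x * K x
    simp only [hKR] at this
    exact this
  have hint : ∀ {g : EuclideanSpace ℝ (Fin n) → ℝ}, Continuous g →
      Integrable (fun x : unitSphere n => g x) (surfaceMeasure n) := fun hg =>
    integrable_of_continuous_unitSphere (hg.comp continuous_subtype_val)
  have hsplit : 2 * ((∫ x : unitSphere n, F x * K x ∂(surfaceMeasure n)) -
        kernelMass y k * F y) =
      ∫ x : unitSphere n, (F x + F (R x) - 2 * F y) * K x ∂(surfaceMeasure n) := by
    simp only [sub_mul, add_mul]
    rw [integral_sub (hint (g := fun x => F x * K x + F (R x) * K x) (by fun_prop))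
        (hint (g := fun x => 2 * F y * K x) (by fun_prop)),
      integral_add (hint (g := fun x => F x * K x) (by fun_prop))
        (hint (g := fun x => F (R x) * K x) (by fun_prop)), hrefl, integral_const_mul,
      integral_kernel]
    ring
  have hbound : |∫ x : unitSphere n, (F x + F (R x) - 2 * F y) * K x ∂(surfaceMeasure n)| ≤
      C * (n * kernelMass y k / (k + 1)) := by
    refine le_trans ?_ (mul_le_mul_of_nonneg_left (integral_one_sub_inner_mul_kernel_le hy k) hC)
    rw [← integral_const_mul, ← Real.norm_eq_abs]
    refine norm_integral_le_of_norm_le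
      (hint (g := fun x => C * ((1 - inner ℝ y x) * K x)) (by fun_prop)) (.of_forall fun x => ?_)
    rw [norm_mul, Real.norm_of_nonneg (sq_nonneg _ : 0 ≤ K x), ← mul_assoc, Real.norm_eq_abs]
    exact mul_le_mul_of_nonneg_right (hsym x y (by simp) hy) (sq_nonneg _)
  have hlhs : (∫ x, polyFun (unitSphere n) p x * (polyFun (unitSphere n) (kernelRoot y k) x) ^ 2
      ∂(surfaceMeasure n)) = ∫ x : unitSphere n, F x * K x ∂(surfaceMeasure n) := by
    simp only [polyFun, eval_kernelRoot, hF, hK]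
  rw [hlhs]
  change |_ / kernelMass y k - F y| ≤ _
  rw [← hsplit, abs_mul, abs_two] at hbound
  rw [div_sub' hmass.ne', abs_div, abs_of_pos hmass, div_le_iff₀ hmass]
  calc _ ≤ C * (n * kernelMass y k / (k + 1)) / 2 := by linarith
    _ = _ := by ring

end Kernel

/-! ### Replacing a measure by finitely many atoms. -/

section Discretization

/-- A finite measure can be replaced by a finitely supported one of bounded
mass, up to an arbitrarily small error in finitely many integrals. -/
theorem exists_atomic_approx {X : Type*} [MeasurableSpace X] (ν : Measure X) [IsFiniteMeasure ν]
    {ι : Type*} [Fintype ι] (g : ι → X → ℝ) (hg : ∀ i, Integrable (g i) ν) {ε : ℝ} (hε : 0 < ε) :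
    ∃ (κ : Type) (_ : Fintype κ) (w : κ → ℝ) (y : κ → X), (∀ j, 0 ≤ w j) ∧
      ∑ j, w j = ν.real Set.univ ∧
      ∀ i, |∑ j, w j * g i (y j) - ∫ x, g i x ∂ν| ≤ ε := by
  rcases eq_or_ne ν 0 with rfl | hν
  · exact ⟨Empty, inferInstance, Empty.elim, Empty.elim, by simp, by simp, by simp [hε.le]⟩
  have : NeZero ν := ⟨hν⟩
  have hmass : 0 < ν.real Set.univ :=
    ENNReal.toReal_pos (by rwa [Ne, Measure.measure_univ_eq_zero]) (measure_ne_top _ _)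
  set G : X → ι → ℝ := fun x i => g i x
  have hG : Integrable G ν := Integrable.of_eval hg
  -- The mean of the vector `G` lies in the closed convex hull of its values; a nearby point of the
  -- hull itself is a finite convex combination, which supplies the atoms.
  have hmem : (⨍ x, G x ∂ν) ∈ closure (convexHull ℝ (Set.range G)) :=
    (convex_convexHull ℝ _).closure.average_mem isClosed_closure
      (.of_forall fun x => subset_closure (subset_convexHull ℝ _ (Set.mem_range_self x))) hG
  obtain ⟨z, hz, hdist⟩ := Metric.mem_closure_iff.1 hmem (ε / ν.real Set.univ) (by positivity)
  obtain ⟨κ, hκ, w, q, hw, hw1, hq, hzq⟩ := mem_convexHull_iff_exists_fintype.1 hz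
  choose y hy using hq
  refine ⟨κ, hκ, fun j => ν.real Set.univ * w j, y, fun j => mul_nonneg hmass.le (hw j), ?_,
    fun i => ?_⟩
  · rw [← Finset.mul_sum, hw1, mul_one]
  · have hzi : z i = ∑ j, w j * g i (y j) := by
      rw [← hzq, Finset.sum_apply]
      exact Finset.sum_congr rfl fun j _ => by rw [← hy j]; rfl
    have havg : (∫ x, g i x ∂ν) = ν.real Set.univ * (⨍ x, G x ∂ν) i := by
      rw [average_eq, Pi.smul_apply, eval_integral hg, smul_eq_mul, mul_inv_cancel_left₀ hmass.ne']
    have hi : |(⨍ x, G x ∂ν) i - z i| ≤ ε / ν.real Set.univ :=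
      (dist_le_pi_dist _ z i).trans hdist.le
    simp only [mul_assoc]
    rw [← Finset.mul_sum, ← hzi, havg, ← mul_sub, abs_mul, abs_of_pos hmass, abs_sub_comm]
    rwa [le_div_iff₀' hmass] at hi

end Discretization

/-! ### Sum-of-squares densities approximating a measure. -/

section Approximation

variable {n : ℕ} [Nontrivial (EuclideanSpace ℝ (Fin n))]

/-- The moments of a finite measure on the sphere are approximated, with error `O(1 / r)`, by
those of a sum-of-squares density of degree at most `2r`. -/
theorem exists_sos_approx {ι : Type*} [Fintype ι] (p : ι → MvPolynomial (Fin n) ℝ)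
    (ν : Measure (unitSphere n)) [IsFiniteMeasure ν] :
    ∃ (h : ℕ → MvPolynomial (Fin n) ℝ) (C : ℝ), (∀ r, h r ∈ sosPolys n r) ∧
      ∀ r : ℕ, 1 ≤ r → ∀ i,
        |(∫ x, polyFun (unitSphere n) (p i) x * polyFun (unitSphere n) (h r) x
            ∂(surfaceMeasure n)) - ∫ x, polyFun (unitSphere n) (p i) x ∂ν| ≤ C / r := by
  choose A hA0 hA using fun i => exists_kernel_approx (p i)
  set B := ∑ i, A i with hB
  have hAB : ∀ i, A i ≤ B := fun i =>
    Finset.single_le_sum (f := A) (fun j _ => hA0 j) (Finset.mem_univ i)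
  have main : ∀ r : ℕ, ∃ q : MvPolynomial (Fin n) ℝ, q ∈ sosPolys n r ∧ (1 ≤ r → ∀ i,
      |(∫ x, polyFun (unitSphere n) (p i) x * polyFun (unitSphere n) q x
          ∂(surfaceMeasure n)) - ∫ x, polyFun (unitSphere n) (p i) x ∂ν| ≤
        (ν.real Set.univ * B + 1) / r) := by
    intro r
    -- The kernel of index `k = r - 1` has degree at most `2r`; at `r = 0` only membership in
    -- `sosPolys` is required.
    rcases r with _ | k
    · exact ⟨0, ⟨IsSumSq.zero, by simp⟩, by simp⟩
    obtain ⟨κ, _, w, y, hw, hw1, hwy⟩ := exists_atomic_approx ν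
      (fun i => polyFun (unitSphere n) (p i))
      (fun i => integrable_of_continuous_unitSphere (continuous_polyFun _ _))
      (ε := 1 / ((k : ℝ) + 1)) (by positivity)
    have hm : ∀ j, 0 < kernelMass (y j).1 k := fun j =>
      kernelMass_pos (by simp) k
    set c : κ → ℝ := fun j => w j / kernelMass (y j).1 k with hc
    have hc0 : ∀ j, 0 ≤ c j := fun j => div_nonneg (hw j) (hm j).le
    -- The density is the mixture of normalized kernels; the nonnegative weights enter the squares
    -- through their roots.
    refine ⟨∑ j, (MvPolynomial.C (√(c j)) *
        kernelRoot (y j).1 k) ^ 2,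
      ⟨IsSumSq.sum_sq _ _, MvPolynomial.totalDegree_finsetSum_le fun j _ => ?_⟩, fun _ i => ?_⟩
    · refine (MvPolynomial.totalDegree_pow _ _).trans (Nat.mul_le_mul_left 2 ?_)
      refine (MvPolynomial.totalDegree_mul _ _).trans ?_
      rw [MvPolynomial.totalDegree_C, zero_add]
      exact totalDegree_kernelRoot_le _ k
    · have hint : ∀ j, Integrable (fun x => polyFun (unitSphere n) (p i) x *
          polyFun (unitSphere n) (kernelRoot (y j).1 k) x ^ 2)
          (surfaceMeasure n) := fun j =>
        integrable_of_continuous_unitSphere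
          ((continuous_polyFun _ _).mul ((continuous_polyFun _ _).pow 2))
      set I : κ → ℝ := fun j => ∫ x, polyFun (unitSphere n) (p i) x *
          polyFun (unitSphere n) (kernelRoot (y j).1 k) x ^ 2
          ∂(surfaceMeasure n) with hI
      have e : ∀ x, polyFun (unitSphere n) (p i) x * polyFun (unitSphere n)
          (∑ j, (MvPolynomial.C (√(c j)) *
            kernelRoot (y j).1 k) ^ 2) x =
          ∑ j, c j * (polyFun (unitSphere n) (p i) x *
            polyFun (unitSphere n) (kernelRoot (y j).1 k) x ^ 2) := by
        intro x
        simp only [polyFun, map_sum, map_pow, map_mul, MvPolynomial.eval_C, Finset.mul_sum]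
        refine Finset.sum_congr rfl fun j _ => ?_
        rw [mul_pow, Real.sq_sqrt (hc0 j)]
        ring
      have hsum : (∫ x, polyFun (unitSphere n) (p i) x * polyFun (unitSphere n)
          (∑ j, (MvPolynomial.C (√(c j)) *
            kernelRoot (y j).1 k) ^ 2) x ∂(surfaceMeasure n)) =
          ∑ j, w j * (I j / kernelMass (y j).1 k) := by
        simp only [e]
        rw [integral_finsetSum _ fun j _ => (hint j).const_mul _]
        refine Finset.sum_congr rfl fun j _ => ?_
        rw [integral_const_mul, hc]
        ring
      have hker : |∑ j, w j * (I j / kernelMass (y j).1 k) -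
          ∑ j, w j * polyFun (unitSphere n) (p i) (y j)| ≤
          ν.real Set.univ * (B / (k + 1)) := by
        rw [← Finset.sum_sub_distrib, ← hw1, Finset.sum_mul]
        refine (Finset.abs_sum_le_sum_abs _ _).trans (Finset.sum_le_sum fun j _ => ?_)
        rw [← mul_sub, abs_mul, abs_of_nonneg (hw j)]
        refine mul_le_mul_of_nonneg_left ((hA i (y j) k).trans ?_) (hw j)
        gcongr
        exact hAB i
      rw [hsum]
      refine (abs_sub_le _ (∑ j, w j * polyFun (unitSphere n) (p i) (y j)) _).trans
        ((add_le_add hker (hwy i)).trans (le_of_eq ?_))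
      push_cast
      ring
  choose h hh using main
  exact ⟨h, ν.real Set.univ * B + 1, fun r => (hh r).1, fun r hr => (hh r).2 hr⟩

end Approximation

end SphereMoments

/-! ### The generalized problem of moments. -/

theorem mainTheorem2 (n m : ℕ) (hn : 1 ≤ n)
    (f₀ : MvPolynomial (Fin n) ℝ) (f : Fin m → MvPolynomial (Fin n) ℝ) (b : Fin m → ℝ)
    (M : Set (Measure (SphereMoments.unitSphere n)))
    (hM : M = SphereMoments.positiveMeasures (SphereMoments.unitSphere n) ∨
      M = SphereMoments.probabilityMeasures (SphereMoments.unitSphere n))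
    (hopt : ∃ ν, SphereMoments.IsGPMOptimal M
      (SphereMoments.polyFun (SphereMoments.unitSphere n) f₀)
      (fun i => SphereMoments.polyFun (SphereMoments.unitSphere n) (f i)) b ν) :
    ∃ (h : ℕ → MvPolynomial (Fin n) ℝ) (C : ℝ),
      (∀ r, h r ∈ SphereMoments.sosPolys n r) ∧
      ∀ r : ℕ, 1 ≤ r →
        |(∫ x, SphereMoments.polyFun (SphereMoments.unitSphere n) f₀ x *
              SphereMoments.polyFun (SphereMoments.unitSphere n) (h r) x
              ∂(SphereMoments.surfaceMeasure n)) -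
            SphereMoments.gpmVal M
              (SphereMoments.polyFun (SphereMoments.unitSphere n) f₀)
              (fun i => SphereMoments.polyFun (SphereMoments.unitSphere n) (f i)) b|
            ≤ C / (r : ℝ) ∧
        ∀ i, |(∫ x, SphereMoments.polyFun (SphereMoments.unitSphere n) (f i) x *
              SphereMoments.polyFun (SphereMoments.unitSphere n) (h r) x
              ∂(SphereMoments.surfaceMeasure n)) - b i|
            ≤ C / (r : ℝ) := by
  obtain ⟨ν, ⟨hνM, hνb⟩, hνmin⟩ := hopt
  have : IsFiniteMeasure ν := by
    rcases hM with rfl | rfl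
    · exact hνM
    · have : IsProbabilityMeasure ν := hνM
      infer_instance
  have : Nontrivial (EuclideanSpace ℝ (Fin n)) :=
    Module.nontrivial_of_finrank_pos (R := ℝ) (by rw [finrank_euclideanSpace_fin]; exact hn)
  have hval : SphereMoments.gpmVal M
      (SphereMoments.polyFun (SphereMoments.unitSphere n) f₀)
      (fun i => SphereMoments.polyFun (SphereMoments.unitSphere n) (f i)) b =
      ∫ x, SphereMoments.polyFun (SphereMoments.unitSphere n) f₀ x ∂ν :=
    IsLeast.csInf_eq ⟨⟨ν, ⟨hνM, hνb⟩, rfl⟩, fun _ ⟨ν', hν', he⟩ => he ▸ hνmin ν' hν'⟩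
  obtain ⟨h, C, hsos, happrox⟩ :=
    -- Indexing by `Option (Fin m)` treats objective and constraints together, with one density and
    -- one constant.
    SphereMoments.exists_sos_approx (fun o : Option (Fin m) => o.elim f₀ f) ν
  refine ⟨h, C, hsos, fun r hr => ⟨?_, fun i => ?_⟩⟩
  · rw [hval]
    exact happrox r hr none
  · rw [← hνb i]
    exact happrox r hr (some i)
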